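/- All groups are abelian and written additively. A \emph{cyclically ordered group} is a group $G$ with a ternary relation $R$ that is strict ($R(a,b,c)$ implies that $a,b,c$ are pairwise distinct), cyclic ($R(a,b,c)\Rightarrow R(b,c,a)$), such that $R(c,\cdot,\cdot)$ is a linear order on $G\setminus\{c\}$ for every $c$, and compatible ($R(a,b,c)\Rightarrow R(u+a,u+b,u+c)$). For $m\ge 2$, $R(x_1,\dots,x_m)$ means that the $x_i$ are pairwise distinct and $R(x_i,x_j,x_k)$ for all $i<j<k$. The \emph{unwound} $\mathrm{uw}(G)$ is the linearly ordered group on the set $\mathbb Z\times G$, with $(n,c)<(n',c')$ iff $n<n'$, or $n=n'$ and ($R(0,c,c')$ or $c=0\ne c'$), and with $(m,a)+(n,b)=(m+n+\epsilon,a+b)$, where $\epsilon=1$ if $a+b=0\neq a$ or $R(0,a+b,a)$, and $\epsilon=0$ otherwise. The linear part $l(G)$ is the image in $G$ of the greatest proper convex subgroup of $\mathrm{uw}(G)$; $G$ is \emph{c-archimedean} if $l(G)=\{0\}$. $G$ is \emph{discrete} if there is an element $1_G\ne 0$ such that $R(0,x,1_G)$ holds for no $x$ (it is then unique). $G$ is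 \emph{c-regular} if for every $n\ge2$ and all $x_1,\dots,x_n\in G$ with $R(0,x_1,\dots,x_n)$ there is $x\in G$ such that ($nx=x_1$ or $nx=x_n$ or $R(x_1,nx,x_n)$) and $R(0,x,\dots,(n-1)x,x_n)$. Let $G$ be discrete and non-c-archimedean with $G/\langle 1_G\rangle$ divisible. A sequence $(\varphi_p)_{p\text{ prime}}$ of functions $\varphi_p:\mathbb N^*\to\{0,\dots,p-1\}$ is the \emph{characteristic sequence} of $G$ if for every prime $p$, $n\in\mathbb N^*$ and $k\in\{0,\dots,p^n-1\}$: there exists $x\in G$ with $R(0,x,2x,\dots,(p^n-1)x)$ and $p^nx=k1_G$ if and only if $k=\varphi_p(1)+\varphi_p(2)p+\cdots+\varphi_p(n)p^{n-1}$. If $z$ is a positive cofinal element of a linearly ordered group $U$, the \emph{wound-round} of $U$ and $z$ is $U/\langle z\rangle$ with $R(\bar a,\bar b,\bar c)$ iff the classes have representatives $a',b',c'\in[0,z[$ with $a'<b'<c'$ or $b'<c'<a'$ or $c'<a'<b'$. \textbf{Proposition.} For every sequence $(\varphi_p)$, indexed by the primes, of functions $\varphi_p:\mathbb N^*\to\{0,\dots,p-1\}$,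 there exists a non-c-archimedean discrete c-regular cyclically ordered group $H$ whose characteristic sequence is $(\varphi_p)$. Moreover $H$ can be taken isomorphic, as a cyclically ordered group, to the wound-round of $W$ and $(1,0)$, where $W$ is the subgroup of the lexicographically ordered group $\mathbb Q\overrightarrow{\times}\mathbb Q$ generated by $(0,1)$ and the elements $$\left(\frac1{p^n},\frac{\varphi_p(1)+\varphi_p(2)p+\cdots+\varphi_p(n)p^{n-1}}{p^n}\right),\qquad p\text{ prime},\ n\in\mathbb N^*.$$ -/

import Mathlib

/-- An (additively written, abelian) cyclically ordered group: an abelian group with a total cyclic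
order whose strict relation `R = sbtw` is compatible with the addition. -/
class IsCyclicallyOrderedAddGroup (G : Type*) [AddCommGroup G] [CircularOrder G] : Prop where
  sbtw_add_left : ∀ (u : G) {a b c : G}, sbtw a b c → sbtw (u + a) (u + b) (u + c)

namespace CyclicGroup

section Order

variable {G : Type*} [CircularOrder G]

/-- The linear order `x <_o y` obtained by cutting the cyclic order at `o`, with `o` as its least
element. -/
def cutLT (o x y : G) : Prop := (x = o ∧ y ≠ o) ∨ sbtw o x y

theorem cutLT_irrefl (o x : G) : ¬ cutLT o x x := by
  rintro (⟨h, h'⟩ | h)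
  · exact h' h
  · exact sbtw_irrefl_right h

theorem ne_of_sbtw {a b c : G} (h : sbtw a b c) : a ≠ b ∧ b ≠ c ∧ a ≠ c := by
  refine ⟨?_, ?_, ?_⟩ <;> rintro rfl
  · exact sbtw_irrefl_left h
  · exact sbtw_irrefl_right h
  · exact sbtw_irrefl_left_right h

theorem cutLT_trans {o x y z : G} (h : cutLT o x y) (h' : cutLT o y z) : cutLT o x z := by
  rcases h with ⟨rfl, h⟩ | h
  · rcases h' with ⟨h', _⟩ | h'
    · exact absurd h' h
    · exact Or.inl ⟨rfl, (ne_of_sbtw h').2.2.symm⟩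
  · rcases h' with ⟨h', _⟩ | h'
    · exact absurd h'.symm (ne_of_sbtw h).2.2
    · exact Or.inr (sbtw_trans_right h h')

theorem sbtw_or_of_ne {a b c : G} (hab : a ≠ b) (hbc : b ≠ c) (hac : a ≠ c) :
    sbtw a b c ∨ sbtw a c b := by
  by_cases h : sbtw a b c
  · exact Or.inl h
  · right
    rw [sbtw_iff_not_btw, not_not] at h
    refine sbtw_iff_btw_not_btw.2 ⟨h.cyclic_left.cyclic_left, fun h' => ?_⟩
    rcases btw_antisymm h' h.cyclic_left.cyclic_left with h | h | h <;> simp_all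

theorem cutLT_total (o x y : G) : cutLT o x y ∨ x = y ∨ cutLT o y x := by
  by_cases hxy : x = y
  · exact Or.inr (Or.inl hxy)
  by_cases hx : x = o
  · exact Or.inl (Or.inl ⟨hx, fun h => hxy (hx.trans h.symm)⟩)
  by_cases hy : y = o
  · exact Or.inr (Or.inr (Or.inl ⟨hy, hx⟩))
  rcases sbtw_or_of_ne (Ne.symm hx) hxy (Ne.symm hy) with h | h
  · exact Or.inl (Or.inr h)
  · exact Or.inr (Or.inr (Or.inr h))

theorem cutLT_asymm {o x y : G} (h : cutLT o x y) : ¬ cutLT o y x :=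
  fun h' => cutLT_irrefl _ _ (cutLT_trans h h')

/-- The cyclic order in terms of the linear order cut at `o`. -/
theorem sbtw_of_cutLT {o a x y : G} (h : cutLT o a x) (h' : cutLT o x y) : sbtw a x y := by
  rcases h with ⟨rfl, h⟩ | h
  · rcases h' with ⟨h', _⟩ | h'
    · exact absurd h' h
    · exact h'
  · rcases h' with ⟨h', _⟩ | h'
    · exact absurd h'.symm (ne_of_sbtw h).2.2
    · exact (sbtw_trans_right h'.cyclic_left h.cyclic_right).cyclic_right

theorem sbtw_iff_cutLT (o a x y : G) :
    sbtw a x y ↔ (cutLT o a x ∧ cutLT o x y) ∨ (cutLT o x y ∧ cutLT o y a) ∨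
      (cutLT o y a ∧ cutLT o a x) := by
  constructor
  · intro h
    have hne := ne_of_sbtw h
    have h1 := cutLT_total o a x
    have h2 := cutLT_total o x y
    have h3 := cutLT_total o y a
    by_contra hc
    have h4 : sbtw y x a := by
      have e1 : cutLT o y x → cutLT o x a → sbtw y x a := fun h h' => sbtw_of_cutLT h h'
      have e2 : cutLT o x a → cutLT o a y → sbtw y x a :=
        fun h h' => (sbtw_of_cutLT h h').cyclic_right
      have e3 : cutLT o a y → cutLT o y x → sbtw y x a :=
        fun h h' => (sbtw_of_cutLT h h').cyclic_left
      have t1 : cutLT o a x → cutLT o x y → cutLT o a y := cutLT_trans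
      have n1 := hne.1
      have n2 := hne.2.1
      have n3 := hne.2.2.symm
      tauto
    exact sbtw_asymm h h4
  · rintro (⟨h, h'⟩ | ⟨h, h'⟩ | ⟨h, h'⟩)
    · exact sbtw_of_cutLT h h'
    · exact (sbtw_of_cutLT h h').cyclic_right
    · exact (sbtw_of_cutLT h h').cyclic_left

/-- `R(x₁, …, xₙ)`: the entries of the list are pairwise distinct and met in this order on one turn.
(Distinctness follows from the other condition once the list has at least three entries.) -/
def IsCyclicList (l : List G) : Prop :=
  l.Pairwise (· ≠ ·) ∧ ∀ a b c : G, [a, b, c].Sublist l → sbtw a b c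

end Order

section Unwound

variable (G : Type*)

/-- The unwound `uw(G)`: the set `ℤ × G`. -/
@[ext]
structure Unwound where
  turn : ℤ
  pt : G

variable {G}

section UnwoundOrder

variable [AddCommGroup G] [CircularOrder G]

/-- `(n, c) < (n', c')` iff `n < n'`, or `n = n'` and `R(0, c, c')`, or `n = n'` and
`c = 0 ≠ c'`. -/
instance : LT (Unwound G) :=
  ⟨fun x y => x.turn < y.turn ∨ (x.turn = y.turn ∧ cutLT 0 x.pt y.pt)⟩

theorem Unwound.lt_def (x y : Unwound G) :
    x < y ↔ x.turn < y.turn ∨ (x.turn = y.turn ∧ cutLT 0 x.pt y.pt) := Iff.rfl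

theorem Unwound.lt_irrefl' (x : Unwound G) : ¬ x < x := by
  rintro (h | ⟨_, h⟩)
  · exact lt_irrefl _ h
  · exact cutLT_irrefl _ _ h

theorem Unwound.lt_trans' {x y z : Unwound G} (h : x < y) (h' : y < z) : x < z := by
  rcases h with h | ⟨h, k⟩ <;> rcases h' with h' | ⟨h', k'⟩
  · exact Or.inl (h.trans h')
  · exact Or.inl (h' ▸ h)
  · exact Or.inl (h ▸ h')
  · exact Or.inr ⟨h.trans h', cutLT_trans k k'⟩

open Classical in
noncomputable instance : LinearOrder (Unwound G) where
  le x y := x < y ∨ x = y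
  le_refl x := Or.inr rfl
  le_trans x y z h h' := by
    rcases h with h | rfl
    · rcases h' with h' | rfl
      · exact Or.inl (Unwound.lt_trans' h h')
      · exact Or.inl h
    · exact h'
  lt_iff_le_not_ge x y := by
    constructor
    · intro h
      refine ⟨Or.inl h, ?_⟩
      rintro (h' | rfl)
      · exact Unwound.lt_irrefl' _ (Unwound.lt_trans' h h')
      · exact Unwound.lt_irrefl' _ h
    · rintro ⟨h | rfl, h'⟩
      · exact h
      · exact absurd (Or.inr rfl) h'
  le_antisymm x y h h' := by
    rcases h with h | h
    · rcases h' with h' | h'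
      · exact absurd (Unwound.lt_trans' h h') (Unwound.lt_irrefl' _)
      · exact h'.symm
    · exact h
  le_total x y := by
    rcases lt_trichotomy x.turn y.turn with h | h | h
    · exact Or.inl (Or.inl (Or.inl h))
    · rcases cutLT_total 0 x.pt y.pt with k | k | k
      · exact Or.inl (Or.inl (Or.inr ⟨h, k⟩))
      · exact Or.inl (Or.inr (Unwound.ext h k))
      · exact Or.inr (Or.inl (Or.inr ⟨h.symm, k⟩))
    · exact Or.inr (Or.inl (Or.inl h))
  toDecidableLE := Classical.decRel _

end UnwoundOrder

variable [AddCommGroup G] [CircularOrder G]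

open Classical in
/-- The carry in the sum of `a` and `b`: it is `1` if `a + b = 0 ≠ a` or `R(0, a + b, a)`, and `0`
otherwise, that is, if `a = 0`, `b = 0` or `R(0, a, a + b)`. -/
noncomputable def carry (a b : G) : ℤ :=
  if (a + b = 0 ∧ a ≠ 0) ∨ sbtw 0 (a + b) a then 1 else 0

noncomputable instance : Add (Unwound G) :=
  ⟨fun x y => ⟨x.turn + y.turn + carry x.pt y.pt, x.pt + y.pt⟩⟩

instance : Zero (Unwound G) := ⟨⟨0, 0⟩⟩

open Classical in
noncomputable instance : Neg (Unwound G) :=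
  ⟨fun x => ⟨if x.pt = 0 then -x.turn else -x.turn - 1, -x.pt⟩⟩

theorem carry_eq (a b : G) [Decidable (cutLT 0 (a + b) a)] :
    carry a b = if cutLT 0 (a + b) a then 1 else 0 := by
  unfold carry cutLT
  congr

theorem cutLT_add_left [IsCyclicallyOrderedAddGroup G] (u : G) {o x y : G} :
    cutLT (u + o) (u + x) (u + y) ↔ cutLT o x y := by
  have key : sbtw (u + o) (u + x) (u + y) ↔ sbtw o x y := by
    refine ⟨fun h => ?_, IsCyclicallyOrderedAddGroup.sbtw_add_left u⟩
    simpa using IsCyclicallyOrderedAddGroup.sbtw_add_left (-u) h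
  simp [cutLT, key]

theorem carry_assoc [IsCyclicallyOrderedAddGroup G] (a b c : G) :
    carry a b + carry (a + b) c = carry b c + carry a (b + c) := by
  classical
  have hb : cutLT 0 (b + c) b ↔ cutLT a (a + b + c) (a + b) := by
    have := cutLT_add_left a (o := 0) (x := b + c) (y := b)
    rwa [add_zero, ← add_assoc, Iff.comm] at this
  simp only [carry_eq, hb, ← add_assoc]
  generalize a + b + c = t
  generalize a + b = s
  have hcut : cutLT a t s ↔ (t = a ∧ s ≠ a) ∨ (cutLT 0 a t ∧ cutLT 0 t s) ∨
      (cutLT 0 t s ∧ cutLT 0 s a) ∨ (cutLT 0 s a ∧ cutLT 0 a t) := by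
    rw [← sbtw_iff_cutLT]
    rfl
  have h1 := cutLT_total 0 a t
  have h2 := cutLT_total 0 t s
  have h3 := cutLT_total 0 s a
  have t1 : cutLT 0 t s → cutLT 0 s a → cutLT 0 t a := cutLT_trans
  have t2 : cutLT 0 a t → cutLT 0 t s → cutLT 0 a s := cutLT_trans
  have t3 : cutLT 0 s a → cutLT 0 a t → cutLT 0 s t := cutLT_trans
  have a1 : cutLT 0 a t → ¬ cutLT 0 t a := cutLT_asymm
  have a2 : cutLT 0 t s → ¬ cutLT 0 s t := cutLT_asymm
  have a3 : cutLT 0 s a → ¬ cutLT 0 a s := cutLT_asymm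
  have t4 : cutLT 0 a s → cutLT 0 s t → cutLT 0 a t := cutLT_trans
  have i1 := cutLT_irrefl 0 a
  clear hb
  generalize cutLT a t s = P at hcut ⊢
  grind

theorem carry_zero_left (a : G) : carry 0 a = 0 := by
  classical
  rw [carry_eq, if_neg]
  rintro (⟨_, h⟩ | h)
  · exact h rfl
  · exact sbtw_irrefl_left_right h

theorem carry_zero_right (a : G) : carry a 0 = 0 := by
  classical
  rw [carry_eq, if_neg]
  rw [add_zero]
  exact cutLT_irrefl _ _

noncomputable instance [IsCyclicallyOrderedAddGroup G] : AddGroup (Unwound G) where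
  add_assoc x y z := by
    refine Unwound.ext ?_ (add_assoc x.pt y.pt z.pt)
    change x.turn + y.turn + carry x.pt y.pt + z.turn + carry (x.pt + y.pt) z.pt =
      x.turn + (y.turn + z.turn + carry y.pt z.pt) + carry x.pt (y.pt + z.pt)
    linarith [carry_assoc x.pt y.pt z.pt]
  zero_add x := by
    refine Unwound.ext ?_ (zero_add x.pt)
    change 0 + x.turn + carry 0 x.pt = x.turn
    rw [carry_zero_left]
    ring
  add_zero x := by
    refine Unwound.ext ?_ (add_zero x.pt)
    change x.turn + 0 + carry x.pt 0 = x.turn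
    rw [carry_zero_right]
    ring
  nsmul := nsmulRec
  zsmul := zsmulRec
  neg_add_cancel x := by
    classical
    refine Unwound.ext ?_ (neg_add_cancel x.pt)
    change (if x.pt = 0 then -x.turn else -x.turn - 1) + x.turn + carry (-x.pt) x.pt = 0
    by_cases h : x.pt = 0
    · rw [if_pos h, h, carry_zero_right]
      ring
    · rw [if_neg h, carry, if_pos (Or.inl ⟨neg_add_cancel _, neg_ne_zero.2 h⟩)]
      ring

/-- The canonical epimorphism from `uw(G)` onto `G`; its kernel is generated by `z_G = (1, 0)`. -/
def Unwound.proj (G : Type*) [AddCommGroup G] [CircularOrder G] [IsCyclicallyOrderedAddGroup G] :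
    Unwound G →+ G where
  toFun := Unwound.pt
  map_zero' := rfl
  map_add' _ _ := rfl

end Unwound

section Notions

variable (G : Type*) [AddCommGroup G] [CircularOrder G]

/-- The linear part `l(G)`: the image in `G` of the greatest proper convex subgroup of `uw(G)`
(convex subgroups of `uw(G)` form a chain, and those that are proper do not contain the cofinal
element `z_G`, so that the supremum below is this greatest subgroup). -/
noncomputable def linearPart [IsCyclicallyOrderedAddGroup G] : AddSubgroup G :=
  (sSup {C : AddSubgroup (Unwound G) | (C : Set (Unwound G)).OrdConnected ∧ C ≠ ⊤}).map
    (Unwound.proj G)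

/-- `G` is c-archimedean if its linear part is trivial. -/
def IsCArchimedean [IsCyclicallyOrderedAddGroup G] : Prop := linearPart G = ⊥

variable {G} in
/-- `e` is the first positive element `1_G` of `G`: the least nonzero element for the linear order
obtained by cutting the cyclic order at `0`. -/
def IsFirstPositive (e : G) : Prop := e ≠ 0 ∧ ∀ x : G, ¬ sbtw 0 x e

/-- `G` is discrete if it has a first positive element. -/
def IsDiscrete : Prop := ∃ e : G, IsFirstPositive e

/-- `G` is c-`n`-regular: for all `x₁, …, xₙ` with `R(0, x₁, …, xₙ)` there is `y` with
`R(x₁, n y, xₙ)` or `n y = x₁` or `n y = xₙ`, and with `R(0, y, …, (n - 1) y, xₙ)`. -/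
def IsCNRegular (n : ℕ) : Prop :=
  ∀ x : ℕ → G, IsCyclicList (0 :: (List.range n).map fun i => x (i + 1)) →
    ∃ y : G, (sbtw (x 1) (n • y) (x n) ∨ n • y = x 1 ∨ n • y = x n) ∧
      IsCyclicList ((List.range n).map (fun j => j • y) ++ [x n])

/-- `G` is c-regular if it is c-`n`-regular for every `n ≥ 2`. -/
def IsCRegular : Prop := ∀ n : ℕ, 2 ≤ n → IsCNRegular G n

variable {G} in
/-- The formula `D_{q,k}` (with `1_G = e`): there is `x` such that `R(0, x, 2x, …, (q - 1)x)` and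
`q x = k 1_G`. -/
def SatisfiesD (e : G) (q k : ℕ) : Prop :=
  ∃ x : G, IsCyclicList ((List.range q).map fun j => j • x) ∧ q • x = k • e

end Notions

/-- The integer `φ_p(1) + φ_p(2) p + ⋯ + φ_p(n) p ^ (n - 1)`. -/
def digitSum (φ : (p : Nat.Primes) → ℕ+ → Fin p) (p : Nat.Primes) (n : ℕ+) : ℕ :=
  ∑ i : Fin n, (φ p ⟨i + 1, Nat.succ_pos i⟩ : ℕ) * (p : ℕ) ^ (i : ℕ)

/-- `φ` is the characteristic sequence of `G`, where `G` is discrete, not c-archimedean, and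
`G / ⟨1_G⟩` is divisible: `D_{p ^ n, k}` holds in `G` exactly for
`k = φ_p(1) + φ_p(2) p + ⋯ + φ_p(n) p ^ (n - 1)`. -/
def IsCharacteristicSequence (G : Type*) [AddCommGroup G] [CircularOrder G]
    [IsCyclicallyOrderedAddGroup G] (φ : (p : Nat.Primes) → ℕ+ → Fin p) : Prop :=
  ¬ IsCArchimedean G ∧ ∃ e : G, IsFirstPositive e ∧
    (∀ m : ℕ, m ≠ 0 → ∀ x : G ⧸ AddSubgroup.zmultiples e, ∃ y, m • y = x) ∧
    ∀ (p : Nat.Primes) (n : ℕ+) (k : ℕ), k < (p : ℕ) ^ (n : ℕ) →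
      (SatisfiesD e ((p : ℕ) ^ (n : ℕ)) k ↔ k = digitSum φ p n)

/-- The relation of the wound-round `U / ⟨z⟩` of a linearly ordered group `U`: `R(a, b, c)` iff the
classes have representatives `a', b', c'` in `[0, z[` with `a' < b' < c'`, `b' < c' < a'` or
`c' < a' < b'`. -/
def woundRoundRel {U : Type*} [AddCommGroup U] [LinearOrder U] (z : U)
    (a b c : U ⧸ AddSubgroup.zmultiples z) : Prop :=
  ∃ a' b' c' : U, (a' : U ⧸ AddSubgroup.zmultiples z) = a ∧
    (b' : U ⧸ AddSubgroup.zmultiples z) = b ∧ (c' : U ⧸ AddSubgroup.zmultiples z) = c ∧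
    (0 ≤ a' ∧ a' < z) ∧ (0 ≤ b' ∧ b' < z) ∧ (0 ≤ c' ∧ c' < z) ∧
    ((a' < b' ∧ b' < c') ∨ (b' < c' ∧ c' < a') ∨ (c' < a' ∧ a' < b'))

/-- `G` is isomorphic to the wound-round associated to `U` and its positive cofinal element `z`. -/
def IsWoundRound (G : Type*) [AddCommGroup G] [CircularOrder G]
    (U : Type*) [AddCommGroup U] [LinearOrder U] (z : U) : Prop :=
  0 < z ∧ (∀ u : U, ∃ m : ℕ, u ≤ m • z) ∧
    ∃ f : G ≃+ U ⧸ AddSubgroup.zmultiples z,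
      ∀ a b c : G, sbtw a b c ↔ woundRoundRel z (f a) (f b) (f c)

/-- The subgroup of the lexicographic product `ℚ × ℚ` generated by `(0, 1)` and all
`(1 / p ^ n, k / p ^ n)`, where `p` is prime, `n ≥ 1` and
`k = φ_p(1) + φ_p(2) p + ⋯ + φ_p(n) p ^ (n - 1)`. -/
def lexSubgroup (φ : (p : Nat.Primes) → ℕ+ → Fin p) : AddSubgroup (ℚ ×ₗ ℚ) :=
  AddSubgroup.closure ({toLex (0, 1)} ∪
    {w | ∃ (p : Nat.Primes) (n : ℕ+),
      w = toLex (1 / (p : ℚ) ^ (n : ℕ), (digitSum φ p n : ℚ) / (p : ℚ) ^ (n : ℕ))})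

theorem one_zero_mem_lexSubgroup (φ : (p : Nat.Primes) → ℕ+ → Fin p) :
    toLex ((1 : ℚ), (0 : ℚ)) ∈ lexSubgroup φ := by
  let p : Nat.Primes := ⟨2, Nat.prime_two⟩
  have h0 : toLex ((0 : ℚ), (1 : ℚ)) ∈ lexSubgroup φ :=
    AddSubgroup.subset_closure (Or.inl rfl)
  have h1 : toLex (1 / (p : ℚ) ^ ((1 : ℕ+) : ℕ),
      (digitSum φ p 1 : ℚ) / (p : ℚ) ^ ((1 : ℕ+) : ℕ)) ∈ lexSubgroup φ :=
    AddSubgroup.subset_closure (Or.inr ⟨p, 1, rfl⟩)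
  have h2 := (lexSubgroup φ).sub_mem ((lexSubgroup φ).nsmul_mem h1 2)
    ((lexSubgroup φ).nsmul_mem h0 (digitSum φ p 1))
  convert h2 using 1
  apply ofLex.injective
  refine Prod.ext ?_ ?_
  · simp [p]
  · simp [p]
    ring

end CyclicGroup

/-! The group is `H = W/⟨(1,0)⟩`, and everything rests on two facts about `W`. Let `α_p` be the
`p`-adic integer with digits `φ_p`. Every generator `(x, y)` satisfies `y - α_p x ∈ ℤ_p` for all
`p`, so every element of `W` does. With `x = 0` this makes `y` an integer, so `W ∩ ({0} × ℚ)` is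
`ℤ(0,1)` (`exists_intCast_of_mem_lexSubgroup`). Also, the first coordinates of `W` fill `ℚ`
(`exists_mem_lexSubgroup`). Hence `(0,1)` is the least positive element, `ℤ(0,1)` is a proper convex
subgroup and `W/ℤ(0,1) ≅ ℚ` is divisible.

These properties pass to the wound-round. The convex subgroup survives in the unwound, so `H` is not
c-archimedean (`not_isCArchimedean_quotient`); discreteness and divisibility modulo the unit give
c-regularity (`isCRegular_quotient`).

For `D_{q,k}` with `q = p ^ n`, a witness lifts to `y` in `W` with `0 < y`, `(q - 1)y < (1,0)` and
`qy = (m, k)`. The bounds force `m = 1`, so `y = (1/q, k/q)`. Subtracting the generator `(1/q,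
d/q)`, where `d` is the digit sum, leaves `(0, (k - d)/q)`; integrality and `|k - d| < q` give `k =
d` (`satisfiesD_lexUnit_iff`). -/

namespace CyclicGroup

/-! ### Wound-rounds as cyclically ordered groups -/

section WoundRound

/-- `z` is a positive cofinal element of the linearly ordered group `U`. -/
class IsPosCofinal {U : Type*} [AddCommGroup U] [LinearOrder U] (z : U) : Prop where
  pos : 0 < z
  cofinal : ∀ u : U, ∃ m : ℕ, u ≤ m • z

theorem mk_add_zsmul {U : Type*} [AddCommGroup U] {z : U} (u : U) (k : ℤ) :
    ((u + k • z : U) : U ⧸ AddSubgroup.zmultiples z) = u := by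
  rw [QuotientAddGroup.eq, AddSubgroup.mem_zmultiples_iff]
  exact ⟨-k, by rw [neg_zsmul]; abel⟩

variable {U : Type*} [AddCommGroup U] [LinearOrder U] [IsOrderedAddMonoid U] {z : U}

/-- Euclidean division by `z` although `U` need not be archimedean: cofinality of `z` bounds `u` and
`-u`, so a greatest `k` with `k • z ≤ u` exists. -/
theorem exists_sub_zsmul_mem_Ico (z : U) [hz : IsPosCofinal z] (u : U) :
    ∃ k : ℤ, 0 ≤ u - k • z ∧ u - k • z < z := by
  obtain ⟨m, hm⟩ := hz.cofinal u
  obtain ⟨l, hl⟩ := hz.cofinal (-u)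
  obtain ⟨k, hk, hmax⟩ := Int.exists_greatest_of_bdd (P := fun k : ℤ => k • z ≤ u)
    ⟨m, fun k hk => by
      have h : k • z ≤ (m : ℤ) • z := hk.trans (by simpa using hm)
      exact (zsmul_le_zsmul_iff_left hz.pos).1 h⟩
    ⟨-l, by simpa using neg_le.1 hl⟩
  refine ⟨k, sub_nonneg.2 hk, ?_⟩
  by_contra h
  have h1 : (k + 1) • z ≤ u := by
    rw [add_zsmul, one_zsmul]
    have := not_lt.1 h
    rwa [le_sub_iff_add_le, add_comm] at this
  have := hmax _ h1
  omega

theorem exists_rep [IsPosCofinal z] (a : U ⧸ AddSubgroup.zmultiples z) :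
    ∃ u : U, (u : U ⧸ AddSubgroup.zmultiples z) = a ∧ 0 ≤ u ∧ u < z := by
  obtain ⟨u, rfl⟩ := QuotientAddGroup.mk_surjective a
  obtain ⟨k, hk, hk'⟩ := exists_sub_zsmul_mem_Ico z u
  refine ⟨u - k • z, ?_, hk, hk'⟩
  rw [QuotientAddGroup.eq, AddSubgroup.mem_zmultiples_iff]
  exact ⟨k, by abel⟩

/-- The representative in `[0, z[` of a class modulo `z`. -/
noncomputable def rep [IsPosCofinal z] (a : U ⧸ AddSubgroup.zmultiples z) : U :=
  (exists_rep a).choose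

variable [hz : IsPosCofinal z]

@[simp]
theorem mk_rep (a : U ⧸ AddSubgroup.zmultiples z) :
    ((rep a : U) : U ⧸ AddSubgroup.zmultiples z) = a := (exists_rep a).choose_spec.1

theorem rep_nonneg (a : U ⧸ AddSubgroup.zmultiples z) : 0 ≤ rep a :=
  (exists_rep a).choose_spec.2.1

theorem rep_lt (a : U ⧸ AddSubgroup.zmultiples z) : rep a < z :=
  (exists_rep a).choose_spec.2.2

theorem rep_injective : Function.Injective (rep : U ⧸ AddSubgroup.zmultiples z → U) :=
  Function.LeftInverse.injective mk_rep

theorem rep_mk {u : U} (h : 0 ≤ u) (h' : u < z) :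
    rep (u : U ⧸ AddSubgroup.zmultiples z) = u := by
  obtain ⟨a, ha⟩ : ∃ a : U ⧸ AddSubgroup.zmultiples z, a = (u : U ⧸ AddSubgroup.zmultiples z) :=
    ⟨_, rfl⟩
  rw [← ha]
  have h1 := (mk_rep a).trans ha
  have h2 := rep_nonneg a
  have h3 := rep_lt a
  rw [QuotientAddGroup.eq, AddSubgroup.mem_zmultiples_iff] at h1
  obtain ⟨k, hk⟩ := h1
  have hk1 : k • z < (1 : ℤ) • z := by
    rw [hk, one_zsmul, neg_add_lt_iff_lt_add]
    exact h'.trans_le (le_add_of_nonneg_left h2)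
  have hk2 : (-1 : ℤ) • z < k • z := by
    rw [hk, neg_one_zsmul, lt_neg_add_iff_add_lt]
    refine lt_of_lt_of_le ?_ h
    rwa [← sub_eq_add_neg, sub_neg]
  have hk1' := (zsmul_lt_zsmul_iff_left hz.pos).1 hk1
  have hk2' := (zsmul_lt_zsmul_iff_left hz.pos).1 hk2
  -- Two points of `[0, z[` differ by strictly less than `z` in either direction, so a difference `k
  -- • z` must vanish.
  obtain rfl : k = 0 := by omega
  rw [zero_zsmul] at hk
  exact (neg_add_eq_zero.1 hk.symm)

@[simp]
theorem rep_zero : rep (0 : U ⧸ AddSubgroup.zmultiples z) = 0 := rep_mk le_rfl hz.pos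

theorem rep_pos {a : U ⧸ AddSubgroup.zmultiples z} (h : a ≠ 0) : 0 < rep a :=
  (rep_nonneg a).lt_of_ne fun h' => h (rep_injective (by rw [rep_zero, h']))

theorem rep_add (a b : U ⧸ AddSubgroup.zmultiples z) :
    (rep a + rep b < z ∧ rep (a + b) = rep a + rep b) ∨
      (z ≤ rep a + rep b ∧ rep (a + b) = rep a + rep b - z) := by
  rcases lt_or_ge (rep a + rep b) z with h | h
  · refine Or.inl ⟨h, ?_⟩
    conv_lhs => rw [← mk_rep a, ← mk_rep b, ← QuotientAddGroup.mk_add]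
    exact rep_mk (add_nonneg (rep_nonneg a) (rep_nonneg b)) h
  · refine Or.inr ⟨h, ?_⟩
    conv_lhs => rw [← mk_rep a, ← mk_rep b, ← QuotientAddGroup.mk_add,
      ← mk_add_zsmul (rep a + rep b) (-1), neg_one_zsmul, ← sub_eq_add_neg]
    refine rep_mk (sub_nonneg.2 h) ?_
    rw [sub_lt_iff_lt_add]
    exact add_lt_add (rep_lt a) (rep_lt b)

noncomputable instance woundRoundCircularOrder : CircularOrder (U ⧸ AddSubgroup.zmultiples z) :=
  letI : LinearOrder (U ⧸ AddSubgroup.zmultiples z) := LinearOrder.lift' rep rep_injective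
  LinearOrder.toCircularOrder _

theorem sbtw_iff_rep {a b c : U ⧸ AddSubgroup.zmultiples z} :
    sbtw a b c ↔ (rep a < rep b ∧ rep b < rep c) ∨ (rep b < rep c ∧ rep c < rep a) ∨
      (rep c < rep a ∧ rep a < rep b) := Iff.rfl

theorem sbtw_iff_woundRoundRel {a b c : U ⧸ AddSubgroup.zmultiples z} :
    sbtw a b c ↔ woundRoundRel z a b c := by
  rw [sbtw_iff_rep]
  constructor
  · intro h
    exact ⟨rep a, rep b, rep c, mk_rep a, mk_rep b, mk_rep c, ⟨rep_nonneg a, rep_lt a⟩,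
      ⟨rep_nonneg b, rep_lt b⟩, ⟨rep_nonneg c, rep_lt c⟩, h⟩
  · rintro ⟨a', b', c', rfl, rfl, rfl, ha, hb, hc, h⟩
    rwa [rep_mk ha.1 ha.2, rep_mk hb.1 hb.2, rep_mk hc.1 hc.2]

theorem sbtw_zero_iff {a b : U ⧸ AddSubgroup.zmultiples z} :
    sbtw 0 a b ↔ 0 < rep a ∧ rep a < rep b := by
  rw [sbtw_iff_rep, rep_zero]
  have := rep_nonneg a
  have := rep_nonneg b
  grind

theorem cutLT_zero_iff {a b : U ⧸ AddSubgroup.zmultiples z} :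
    cutLT 0 a b ↔ rep a < rep b := by
  unfold cutLT
  rw [sbtw_zero_iff]
  constructor
  · rintro (⟨rfl, h⟩ | h)
    · rw [rep_zero]
      exact rep_pos h
    · exact h.2
  · intro h
    by_cases ha : a = 0
    · exact Or.inl ⟨ha, fun hb => by simp [ha, hb] at h⟩
    · exact Or.inr ⟨rep_pos ha, h⟩

/-- Translation by `u` adds `rep u` and subtracts `z` from the representatives that overflow. These
are the largest ones, so an ordered triple is at most rotated cyclically. -/
instance : IsCyclicallyOrderedAddGroup (U ⧸ AddSubgroup.zmultiples z) where
  sbtw_add_left u a b c h := by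
    rw [sbtw_iff_rep] at h ⊢
    have ha := rep_add u a
    have hb := rep_add u b
    have hc := rep_add u c
    have := rep_nonneg a
    have := rep_nonneg b
    have := rep_nonneg c
    have := rep_lt a
    have := rep_lt b
    have := rep_lt c
    generalize rep (u + a) = a1 at *
    generalize rep (u + b) = b1 at *
    generalize rep (u + c) = c1 at *
    generalize rep a = a0 at *
    generalize rep b = b0 at *
    generalize rep c = c0 at *
    generalize rep u = u0 at *
    grind

theorem isWoundRound_quotient (z : U) [hz : IsPosCofinal z] :
    IsWoundRound (U ⧸ AddSubgroup.zmultiples z) U z :=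
  ⟨hz.pos, hz.cofinal, AddEquiv.refl _, fun _ _ _ => sbtw_iff_woundRoundRel⟩

/-- The carry of the unwound counts the overflow past `z`: one occurs exactly when `rep (a + b) <
rep a`. -/
theorem rep_add_rep (a b : U ⧸ AddSubgroup.zmultiples z) :
    rep a + rep b = rep (a + b) + carry a b • z := by
  classical
  rw [carry_eq]
  simp only [cutLT_zero_iff]
  have := rep_nonneg b
  have := rep_lt b
  rcases rep_add a b with ⟨h, h'⟩ | ⟨h, h'⟩
  · rw [if_neg, zero_zsmul, h', add_zero]
    rw [h', not_lt]
    exact le_add_of_nonneg_right (rep_nonneg b)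
  · rw [if_pos, one_zsmul, h', sub_add_cancel]
    rw [h', sub_lt_iff_lt_add]
    exact add_lt_add_right (rep_lt b) _

/-! ### The unwound of a wound-round and its linear part -/

/-- The map from the unwound of the wound-round of `U` and `z` to `U`. -/
noncomputable def Unwound.toGroup (z : U) [IsPosCofinal z] :
    Unwound (U ⧸ AddSubgroup.zmultiples z) →+ U :=
  AddMonoidHom.mk' (fun x => x.turn • z + rep x.pt) fun x y => by
    change (x.turn + y.turn + carry x.pt y.pt) • z + rep (x.pt + y.pt) = _
    have := rep_add_rep x.pt y.pt
    rw [add_zsmul, add_zsmul, add_assoc, add_comm (carry _ _ • z), ← this]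
    abel

theorem Unwound.toGroup_apply (x : Unwound (U ⧸ AddSubgroup.zmultiples z)) :
    Unwound.toGroup z x = x.turn • z + rep x.pt := rfl

theorem Unwound.toGroup_strictMono : StrictMono (Unwound.toGroup z) := by
  intro x y h
  rw [Unwound.toGroup_apply, Unwound.toGroup_apply]
  rcases h with h | ⟨h, h'⟩
  · calc x.turn • z + rep x.pt < x.turn • z + z := add_lt_add_right (rep_lt _) _
      _ = (x.turn + 1) • z := by rw [add_zsmul, one_zsmul]
      _ ≤ y.turn • z := zsmul_le_zsmul_left hz.pos.le h
      _ ≤ _ := le_add_of_nonneg_right (rep_nonneg _)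
  · rw [h]
    exact add_lt_add_right (cutLT_zero_iff.1 h') _

/-- Pulling `D` back along the monotone `Unwound.toGroup` gives a convex subgroup of the unwound. It
is proper because `(1, 0)` maps to `z ∉ D`, so its image lies in the linear part; that image
contains the nonzero class of `u`. -/
theorem not_isCArchimedean_quotient {D : AddSubgroup U} (hD : (D : Set U).OrdConnected)
    (hzD : z ∉ D) {u : U} (hu : u ∈ D) (h0 : 0 < u) :
    ¬ IsCArchimedean (U ⧸ AddSubgroup.zmultiples z) := by
  have huz : u < z := by
    by_contra h
    exact hzD (hD.out D.zero_mem hu ⟨hz.pos.le, not_lt.1 h⟩)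
  intro h
  unfold IsCArchimedean linearPart at h
  rw [AddSubgroup.map_eq_bot_iff] at h
  have hC : D.comap (Unwound.toGroup z) ≤ (Unwound.proj (U ⧸ AddSubgroup.zmultiples z)).ker := by
    refine (le_sSup ?_).trans h
    refine ⟨hD.preimage_mono Unwound.toGroup_strictMono.monotone, fun htop => hzD ?_⟩
    have : (⟨1, 0⟩ : Unwound (U ⧸ AddSubgroup.zmultiples z)) ∈ D.comap (Unwound.toGroup z) := by
      rw [htop]
      trivial
    simpa [Unwound.toGroup_apply] using this
  have hmem : (⟨0, u⟩ : Unwound (U ⧸ AddSubgroup.zmultiples z)) ∈ D.comap (Unwound.toGroup z) := by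
    simpa [Unwound.toGroup_apply, rep_mk h0.le huz] using hu
  have hker : (u : U ⧸ AddSubgroup.zmultiples z) = 0 := hC hmem
  have := rep_mk h0.le huz
  rw [hker, rep_zero] at this
  exact h0.ne this

/-! ### Cyclic lists, c-regularity and the formulas `D_{q,k}` -/

theorem isCyclicList_map_mk {L : List U} (hL : L.Pairwise (· < ·))
    (hz : ∀ u ∈ L, 0 ≤ u ∧ u < z) :
    IsCyclicList (L.map ((↑) : U → U ⧸ AddSubgroup.zmultiples z)) := by
  constructor
  · rw [List.pairwise_map]
    refine hL.imp_of_mem fun {a b} ha hb hab h => hab.ne ?_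
    rw [← rep_mk (hz a ha).1 (hz a ha).2, ← rep_mk (hz b hb).1 (hz b hb).2, h]
  · intro a b c h
    obtain ⟨l, hl, hl'⟩ := List.sublist_map_iff.1 h
    match l, hl' with
    | [a', b', c'], hl' =>
      simp only [List.map_cons, List.map_nil, List.cons.injEq, and_true] at hl'
      obtain ⟨rfl, rfl, rfl⟩ := hl'
      have ha := hz a' (hl.subset (by simp))
      have hb := hz b' (hl.subset (by simp))
      have hc := hz c' (hl.subset (by simp))
      have hp := hL.sublist hl
      simp only [List.pairwise_cons, List.mem_cons, List.not_mem_nil, or_false] at hp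
      rw [sbtw_iff_rep, rep_mk ha.1 ha.2, rep_mk hb.1 hb.2, rep_mk hc.1 hc.2]
      exact Or.inl ⟨hp.1 _ (Or.inl rfl), hp.2.1 _ rfl⟩

theorem IsCyclicList.rep_pos {n : ℕ} {f : ℕ → U ⧸ AddSubgroup.zmultiples z}
    (h : IsCyclicList (0 :: (List.range n).map f)) {i : ℕ} (hi : i < n) : 0 < rep (f i) := by
  refine CyclicGroup.rep_pos fun h0 => ?_
  exact (List.pairwise_cons.1 h.1).1 (f i)
    (List.mem_map_of_mem (List.mem_range.2 hi)) h0.symm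

theorem IsCyclicList.rep_lt_rep {n : ℕ} {f : ℕ → U ⧸ AddSubgroup.zmultiples z}
    (h : IsCyclicList (0 :: (List.range n).map f)) {i j : ℕ} (hij : i < j) (hj : j < n) :
    rep (f i) < rep (f j) := by
  have hp : ((List.range n).map f).Pairwise fun a b => sbtw 0 a b :=
    List.pairwise_iff_forall_sublist.2 fun hab => h.2 _ _ _ (hab.cons_cons 0)
  rw [List.pairwise_map, List.pairwise_iff_getElem] at hp
  have := hp i j (by simp; omega) (by simpa using hj) hij
  simp only [List.getElem_range] at this
  exact (sbtw_zero_iff.1 this).2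

/-- A wound-round of a discrete regular linearly ordered group is c-regular. -/
theorem isCRegular_quotient {e : U} (he0 : 0 < e) (he : ∀ u : U, 0 < u → e ≤ u)
    (hdiv : ∀ m : ℕ, m ≠ 0 → ∀ u : U, ∃ (v : U) (k : ℤ), u = m • v + k • e) :
    IsCRegular (U ⧸ AddSubgroup.zmultiples z) := by
  intro n hn x hx
  have hlt : ∀ i, i + 1 < n → rep (x (i + 1)) < rep (x (i + 2)) := fun i hi =>
    hx.rep_lt_rep (Nat.lt_succ_self i) hi
  -- Each gap between consecutive entries is positive, hence at least `e`; so `x₁ + i e` stays below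
  -- `xₙ` for all `i < n`.
  have hle : ∀ i, i < n → rep (x 1) + i • e ≤ rep (x (i + 1)) := by
    intro i hi
    induction i with
    | zero => simp
    | succ i ih =>
      have h1 := he _ (sub_pos.2 (hlt i hi))
      rw [le_sub_iff_add_le'] at h1
      rw [succ_nsmul, ← add_assoc]
      exact (add_le_add_left (ih (by omega)) _).trans h1
  obtain ⟨v, k, hv⟩ := hdiv n (by omega) (rep (x 1))
  have hn0 : (n : ℤ) ≠ 0 := by omega
  -- Among `x₁, x₁ + e, …, x₁ + (n - 1)e` one is divisible by `n`: as `x₁ = n v + k e`, take `j` to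
  -- be the residue of `-k` modulo `n`.
  obtain ⟨j, hj, w, hw⟩ : ∃ j < n, ∃ w : U, n • w = rep (x 1) + j • e := by
    refine ⟨((-k) % n).toNat, ?_, v - ((-k) / n) • e, ?_⟩
    · have := Int.emod_lt_of_pos (-k) (by omega : (0 : ℤ) < n)
      have := Int.emod_nonneg (-k) hn0
      omega
    · rw [hv, ← natCast_zsmul e, Int.toNat_of_nonneg (Int.emod_nonneg _ hn0), add_assoc,
        ← add_zsmul, nsmul_sub, sub_eq_add_neg, ← natCast_zsmul, ← natCast_zsmul, smul_smul,
        ← neg_zsmul]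
      congr 2
      have := Int.emod_add_mul_ediv (-k) n
      linarith
  have hx1 : 0 < rep (x 1) := hx.rep_pos (i := 0) (by omega)
  have h1w : rep (x 1) ≤ n • w := hw ▸ le_add_of_nonneg_right (nsmul_nonneg he0.le j)
  have hwn : n • w ≤ rep (x n) := by
    rw [hw]
    refine (add_le_add_right (nsmul_le_nsmul_left he0.le (by omega : j ≤ n - 1)) _).trans ?_
    have := hle (n - 1) (by omega)
    rwa [show n - 1 + 1 = n by omega] at this
  have hw0 : 0 < w := by
    by_contra h
    exact (hx1.trans_le h1w).not_ge (nsmul_nonpos (not_lt.1 h) n)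
  have hnz : n • w < z := hwn.trans_lt (rep_lt _)
  have hrep : rep ((n • w : U) : U ⧸ AddSubgroup.zmultiples z) = n • w :=
    rep_mk (hx1.le.trans h1w) hnz
  have hjw : ∀ j < n, j • w < n • w := fun j hj => nsmul_lt_nsmul_left hw0 hj
  refine ⟨(w : U ⧸ AddSubgroup.zmultiples z), ?_, ?_⟩
  · rw [← QuotientAddGroup.mk_nsmul]
    rcases h1w.lt_or_eq with h1 | h1
    · rcases hwn.lt_or_eq with h2 | h2
      · left
        rw [sbtw_iff_rep, hrep]
        exact Or.inl ⟨h1, h2⟩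
      · right; right
        rw [h2, mk_rep]
    · right; left
      rw [← h1, mk_rep]
  · have key := isCyclicList_map_mk (z := z)
      (L := (List.range n).map (fun j => j • w) ++ [rep (x n)]) ?_ ?_
    · simpa [Function.comp_def] using key
    · rw [List.pairwise_append]
      refine ⟨?_, List.pairwise_singleton _ _, ?_⟩
      · rw [List.pairwise_map]
        exact List.pairwise_lt_range.imp fun h => nsmul_lt_nsmul_left hw0 h
      · simp only [List.mem_map, List.mem_range, List.mem_singleton]
        rintro _ ⟨j, hj, rfl⟩ _ rfl
        exact (hjw j hj).trans_le hwn
    · simp only [List.mem_append, List.mem_map, List.mem_range, List.mem_singleton]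
      rintro u (⟨j, hj, rfl⟩ | rfl)
      · exact ⟨nsmul_nonneg hw0.le j, (hjw j hj).trans hnz⟩
      · exact ⟨rep_nonneg _, rep_lt _⟩

theorem isFirstPositive_mk {e : U} (he0 : 0 < e) (he : ∀ u : U, 0 < u → e ≤ u) (hez : e < z) :
    IsFirstPositive (e : U ⧸ AddSubgroup.zmultiples z) := by
  have hrep := rep_mk he0.le hez
  constructor
  · intro h
    rw [h, rep_zero] at hrep
    exact he0.ne hrep
  · intro x hx
    rw [sbtw_zero_iff, hrep] at hx
    exact (he _ hx.1).not_gt hx.2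

/-- The hypotheses say that the multiples of `y` below `q` stay within one turn, and that `q • y`
exceeds `k • e` by exactly one turn. -/
theorem satisfiesD_mk {e y : U} {q k : ℕ} (hy0 : 0 < y) (hy : (q - 1) • y < z)
    (h : q • y = k • e + z) : SatisfiesD (e : U ⧸ AddSubgroup.zmultiples z) q k := by
  refine ⟨(y : U ⧸ AddSubgroup.zmultiples z), ?_, ?_⟩
  · have key := isCyclicList_map_mk (z := z) (L := (List.range q).map (fun j => j • y)) ?_ ?_
    · simpa [Function.comp_def] using key
    · rw [List.pairwise_map]
      exact List.pairwise_lt_range.imp fun h => nsmul_lt_nsmul_left hy0 h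
    · simp only [List.mem_map, List.mem_range]
      rintro u ⟨j, hj, rfl⟩
      exact ⟨nsmul_nonneg hy0.le j,
        (nsmul_le_nsmul_left hy0.le (by omega : j ≤ q - 1)).trans_lt hy⟩
  · rw [← QuotientAddGroup.mk_nsmul, h, ← QuotientAddGroup.mk_nsmul]
    simp

/-- The ordering of `x, 2x, …, (q - 1)x` after `0` prevents any wrapping, so these multiples are
computed in `U` on the representative of `x`. -/
theorem SatisfiesD.exists_rep {e : U} {q k : ℕ} (hq : 2 ≤ q)
    (h : SatisfiesD (e : U ⧸ AddSubgroup.zmultiples z) q k) :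
    ∃ (y : U) (m : ℤ), 0 < y ∧ (q - 1) • y < z ∧ q • y = k • e + m • z := by
  obtain ⟨x, hx, hqx⟩ := h
  obtain ⟨q, rfl⟩ : ∃ r, q = r + 2 := ⟨q - 2, by omega⟩
  rw [List.range_succ_eq_map, List.map_cons, List.map_map, zero_nsmul] at hx
  have hj : ∀ j, j < q + 1 → (j + 1) • rep x < z ∧ rep ((j + 1) • x) = (j + 1) • rep x := by
    intro j hj
    induction j with
    | zero => simpa using rep_lt x
    | succ j ih =>
      obtain ⟨ih1, ih2⟩ := ih (by omega)
      have hlt : rep ((j + 1) • x) < rep ((j + 1 + 1) • x) :=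
        hx.rep_lt_rep (Nat.lt_succ_self j) hj
      rw [succ_nsmul _ (j + 1)] at hlt ⊢
      rw [succ_nsmul _ (j + 1)]
      have hadd := rep_add ((j + 1) • x) x
      rw [ih2] at hadd hlt
      rcases hadd with hadd | hadd
      · exact hadd
      -- An overflow would send the next multiple strictly below the previous one, since `rep x <
      -- z`.
      · rw [hadd.2, lt_sub_iff_add_lt] at hlt
        exact absurd (lt_of_add_lt_add_left hlt) (rep_lt x).not_gt
  have h1 : ((((q + 2) • rep x : U)) : U ⧸ AddSubgroup.zmultiples z) = ((k • e : U)) := by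
    rw [QuotientAddGroup.mk_nsmul, mk_rep, hqx, QuotientAddGroup.mk_nsmul]
  rw [eq_comm, QuotientAddGroup.eq, AddSubgroup.mem_zmultiples_iff] at h1
  obtain ⟨m, hm⟩ := h1
  refine ⟨rep x, m, ?_, (hj q (by omega)).1, by rw [hm]; abel⟩
  simpa only [Function.comp_apply, Nat.succ_eq_add_one, zero_add, one_nsmul] using
    hx.rep_pos (i := 0) (by omega)

end WoundRound

/-! ### Arithmetic of `W`: integrality and surjectivity -/

section LexSubgroup

/-- A prime dividing the denominator would also have to divide the numerator. -/
theorem Rat.exists_intCast_of_padicNorm_le_one {y : ℚ}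
    (h : ∀ p : Nat.Primes, padicNorm p y ≤ 1) : ∃ k : ℤ, y = k := by
  refine ⟨y.num, ((Rat.den_eq_one_iff y).1 ?_).symm⟩
  by_contra hd
  obtain ⟨p, hp, hpd⟩ := Nat.exists_prime_and_dvd hd
  have : Fact p.Prime := ⟨hp⟩
  have h1 : padicNorm p y * padicNorm p (y.den : ℚ) = padicNorm p (y.num : ℚ) := by
    rw [← padicNorm.mul, Rat.mul_den_eq_num]
  have h2 : padicNorm p (y.den : ℚ) < 1 := (padicNorm.nat_lt_one_iff _).2 hpd
  have h3 : padicNorm p (y.num : ℚ) < 1 := by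
    rw [← h1]
    have := h ⟨p, hp⟩
    have h4 := padicNorm.nonneg (p := p) (y.den : ℚ)
    calc _ ≤ 1 * padicNorm p (y.den : ℚ) := mul_le_mul_of_nonneg_right this h4
      _ < 1 := by rwa [one_mul]
  rw [padicNorm.int_lt_one_iff] at h3
  have := Nat.Coprime.eq_one_of_dvd (y.reduced.symm.coprime_dvd_left hpd)
    (Int.natCast_dvd.1 h3)
  exact hp.one_lt.ne' this

variable (φ : (p : Nat.Primes) → ℕ+ → Fin p)

theorem digitSum_eq_sum_range (p : Nat.Primes) (n : ℕ+) :
    digitSum φ p n =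
      ∑ i ∈ Finset.range n, (φ p ⟨i + 1, Nat.succ_pos i⟩ : ℕ) * (p : ℕ) ^ i :=
  Fin.sum_univ_eq_sum_range
    (fun i => (φ p ⟨i + 1, Nat.succ_pos i⟩ : ℕ) * (p : ℕ) ^ i) n

theorem digitSum_lt (p : Nat.Primes) (n : ℕ+) : digitSum φ p n < (p : ℕ) ^ (n : ℕ) := by
  rw [digitSum_eq_sum_range]
  induction (n : ℕ) with
  | zero => simp
  | succ n ih =>
    rw [Finset.sum_range_succ, pow_succ']
    have h : (φ p ⟨n + 1, Nat.succ_pos n⟩ : ℕ) + 1 ≤ p := (φ p _).isLt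
    have := Nat.mul_le_mul_right ((p : ℕ) ^ n) h
    rw [add_mul, one_mul] at this
    omega

/-- Coherence of the truncations of `α_p`: the later ones agree with the `m`-th modulo `p ^ m`. -/
theorem exists_digitSum_eq_add (p : Nat.Primes) {m n : ℕ+} (h : m ≤ n) :
    ∃ c : ℕ, digitSum φ p n = digitSum φ p m + (p : ℕ) ^ (m : ℕ) * c := by
  obtain ⟨l, hl⟩ := Nat.exists_eq_add_of_le (show (m : ℕ) ≤ n from h)
  rw [digitSum_eq_sum_range, digitSum_eq_sum_range, hl, Finset.sum_range_add]
  refine ⟨∑ i ∈ Finset.range l, (φ p ⟨m + i + 1, Nat.succ_pos _⟩ : ℕ) * (p : ℕ) ^ i, ?_⟩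
  rw [Finset.mul_sum]
  congr 1
  refine Finset.sum_congr rfl fun i _ => ?_
  rw [pow_add]
  ring

/-- The pairs `(x, y)` of rationals such that `y - α_p x` is a `p`-adic integer for each prime `p`,
where `α_p` is the `p`-adic integer with digits `φ_p`. -/
def padicCompatible : AddSubgroup (ℚ ×ₗ ℚ) where
  -- The truncations of `α_p` replace it: for `n` large in terms of the first coordinate, the error
  -- is a `p`-adic integer.
  carrier := {w | ∀ p : Nat.Primes, ∃ N : ℕ+, ∀ n ≥ N,
    padicNorm p ((ofLex w).2 - digitSum φ p n * (ofLex w).1) ≤ 1}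
  zero_mem' p := ⟨1, fun n _ => by simp⟩
  add_mem' {v w} hv hw p := by
    have : Fact (p : ℕ).Prime := ⟨p.2⟩
    obtain ⟨N, hN⟩ := hv p
    obtain ⟨M, hM⟩ := hw p
    refine ⟨max N M, fun n hn => ?_⟩
    have h1 := hN n ((le_max_left _ _).trans hn)
    have h2 := hM n ((le_max_right _ _).trans hn)
    refine le_trans (le_of_eq ?_) ((padicNorm.nonarchimedean (p := p)).trans (max_le h1 h2))
    congr 1
    simp only [ofLex_add, Prod.fst_add, Prod.snd_add]
    ring
  neg_mem' {v} hv p := by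
    obtain ⟨N, hN⟩ := hv p
    refine ⟨N, fun n hn => ?_⟩
    rw [← padicNorm.neg]
    refine le_trans (le_of_eq ?_) (hN n hn)
    congr 1
    simp only [ofLex_neg, Prod.fst_neg, Prod.snd_neg]
    ring

theorem padicNorm_intCast_div_prime_pow_le_one (p : ℕ) [hp : Fact p.Prime] {q : ℕ}
    (hq : q.Prime) (hpq : p ≠ q) (k : ℤ) (n : ℕ) : padicNorm p ((k : ℚ) / (q : ℚ) ^ n) ≤ 1 := by
  rw [padicNorm.div, ← Nat.cast_pow, (padicNorm.nat_eq_one_iff _).2, div_one]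
  · exact padicNorm.of_int k
  · intro h
    exact hpq ((Nat.prime_dvd_prime_iff_eq hp.out hq).1 (hp.out.dvd_of_dvd_pow h))

/-- For a generator of denominator `q ^ m`, the defect at `p = q` is an integer by coherence of the
truncations; at `p ≠ q` the denominator is a `p`-adic unit. -/
theorem lexSubgroup_le_padicCompatible : lexSubgroup φ ≤ padicCompatible φ := by
  refine (AddSubgroup.closure_le _).2 ?_
  rintro w (rfl | ⟨q, m, rfl⟩) p <;> have : Fact (p : ℕ).Prime := ⟨p.2⟩
  · exact ⟨1, fun n _ => by simp⟩
  · have hq0 : ((q : ℕ) : ℚ) ≠ 0 := Nat.cast_ne_zero.2 q.2.ne_zero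
    refine ⟨m, fun n hn => ?_⟩
    simp only [ofLex_toLex]
    by_cases hpq : p = q
    · subst hpq
      obtain ⟨c, hc⟩ := exists_digitSum_eq_add φ p hn
      rw [hc]
      push_cast
      have : (digitSum φ p m : ℚ) / (p : ℚ) ^ (m : ℕ) -
          (digitSum φ p m + (p : ℚ) ^ (m : ℕ) * c) * (1 / (p : ℚ) ^ (m : ℕ)) = (-c : ℤ) := by
        push_cast
        field_simp
        ring
      rw [this]
      exact padicNorm.of_int _
    · have : (digitSum φ q m : ℚ) / (q : ℚ) ^ (m : ℕ) -
          digitSum φ p n * (1 / (q : ℚ) ^ (m : ℕ)) =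
          ((digitSum φ q m - digitSum φ p n : ℤ) : ℚ) / (q : ℚ) ^ (m : ℕ) := by
        push_cast
        ring
      rw [this]
      exact padicNorm_intCast_div_prime_pow_le_one p q.2
        (fun h => hpq (Subtype.ext h)) _ _

theorem exists_intCast_of_mem_lexSubgroup {y : ℚ} (h : toLex (0, y) ∈ lexSubgroup φ) :
    ∃ k : ℤ, y = k := by
  refine Rat.exists_intCast_of_padicNorm_le_one fun p => ?_
  obtain ⟨N, hN⟩ := lexSubgroup_le_padicCompatible φ h p
  simpa using hN N le_rfl

theorem exists_mem_lexSubgroup (x : ℚ) : ∃ y : ℚ, toLex (x, y) ∈ lexSubgroup φ := by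
  let S : AddSubgroup ℚ := (lexSubgroup φ).map
    ((AddMonoidHom.fst ℚ ℚ).comp (ofLexAddEquiv (ℚ × ℚ)).toAddMonoidHom)
  have hinv : ∀ m : ℕ, m ≠ 0 → (1 : ℚ) / m ∈ S := by
    intro m
    induction m using Nat.recOnPosPrimePosCoprime with
    | prime_pow p n hp hn =>
      intro _
      refine ⟨_, AddSubgroup.subset_closure (Or.inr ⟨⟨p, hp⟩, ⟨n, hn⟩, rfl⟩), ?_⟩
      simp
    | zero => exact fun h => absurd rfl h
    | one =>
      intro _
      exact ⟨_, one_zero_mem_lexSubgroup φ, by simp⟩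
    | coprime a b ha hb hab iha ihb =>
      intro _
      -- Bézout: `a s + b t = 1` gives `1/(ab) = s/b + t/a`.
      have h1 := S.add_mem (S.zsmul_mem (ihb (by omega)) (a.gcdA b))
        (S.zsmul_mem (iha (by omega)) (a.gcdB b))
      have h2 : (a : ℚ) * a.gcdA b + b * a.gcdB b = 1 := by
        have := Nat.gcd_eq_gcd_ab a b
        rw [hab] at this
        exact_mod_cast this.symm
      have ha0 : (a : ℚ) ≠ 0 := by positivity
      have hb0 : (b : ℚ) ≠ 0 := by positivity
      convert h1 using 1
      simp only [zsmul_eq_mul]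
      push_cast
      field_simp
      linarith
  have hx : x ∈ S := by
    have := S.zsmul_mem (hinv x.den x.den_ne_zero) x.num
    rwa [zsmul_eq_mul, mul_one_div, Rat.num_div_den] at this
  obtain ⟨w, hw, rfl⟩ := hx
  exact ⟨(ofLex w).2, hw⟩

/-! ### Order structure of `W` and its characteristic sequence -/

theorem Prod.Lex.nsmul_toLex (n : ℕ) (x y : ℚ) :
    n • (toLex (x, y) : ℚ ×ₗ ℚ) = toLex ((n : ℚ) * x, (n : ℚ) * y) := by
  apply ofLex.injective
  change n • ((x, y) : ℚ × ℚ) = _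
  simp

theorem Prod.Lex.zsmul_toLex (n : ℤ) (x y : ℚ) :
    n • (toLex (x, y) : ℚ ×ₗ ℚ) = toLex ((n : ℚ) * x, (n : ℚ) * y) := by
  apply ofLex.injective
  change n • ((x, y) : ℚ × ℚ) = _
  simp

/-- The element `(1, 0)` of the group `lexSubgroup φ`. -/
abbrev lexTurn : lexSubgroup φ := ⟨toLex (1, 0), one_zero_mem_lexSubgroup φ⟩

/-- The element `(0, 1)` of the group `lexSubgroup φ`. -/
abbrev lexUnit : lexSubgroup φ :=
  ⟨toLex (0, 1), AddSubgroup.subset_closure (Or.inl rfl)⟩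

instance : IsPosCofinal (lexTurn φ) where
  pos := by
    change toLex ((0 : ℚ), (0 : ℚ)) < toLex (1, 0)
    rw [Prod.Lex.toLex_lt_toLex]
    simp
  cofinal := by
    rintro ⟨u, hu⟩
    obtain ⟨m, hm⟩ := exists_nat_gt (ofLex u).1
    refine ⟨m, ?_⟩
    change u ≤ m • toLex ((1 : ℚ), (0 : ℚ))
    rw [Prod.Lex.nsmul_toLex, Prod.Lex.le_iff]
    left
    simpa using hm

theorem lexUnit_pos : 0 < lexUnit φ := by
  change toLex ((0 : ℚ), (0 : ℚ)) < toLex (0, 1)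
  rw [Prod.Lex.toLex_lt_toLex]
  simp

theorem zsmul_lexUnit_lt_lexTurn (k : ℤ) : k • lexUnit φ < lexTurn φ := by
  change k • toLex ((0 : ℚ), (1 : ℚ)) < toLex (1, 0)
  rw [Prod.Lex.zsmul_toLex, Prod.Lex.toLex_lt_toLex]
  simp

theorem lexUnit_le {u : lexSubgroup φ} (hu : 0 < u) : lexUnit φ ≤ u := by
  obtain ⟨⟨x, y⟩, hw⟩ := u
  change toLex ((0 : ℚ), (0 : ℚ)) < toLex (x, y) at hu
  change toLex ((0 : ℚ), (1 : ℚ)) ≤ toLex (x, y)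
  rw [Prod.Lex.toLex_lt_toLex] at hu
  rw [Prod.Lex.toLex_le_toLex]
  rcases hu with hu | ⟨hx, hy⟩
  · exact Or.inl hu
  · simp only at hx hy
    subst hx
    obtain ⟨k, rfl⟩ := exists_intCast_of_mem_lexSubgroup φ hw
    refine Or.inr ⟨rfl, ?_⟩
    have hk : 0 < k := by exact_mod_cast hy
    change (1 : ℚ) ≤ k
    exact_mod_cast (show 1 ≤ k from hk)

/-- Lift `x / m` to an element of `W`; subtracting `m` times this lift kills the first coordinate
and leaves an integer multiple of `(0,1)`. -/
theorem exists_eq_nsmul_add_zsmul_lexUnit {m : ℕ} (hm : m ≠ 0) (u : lexSubgroup φ) :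
    ∃ (v : lexSubgroup φ) (k : ℤ), u = m • v + k • lexUnit φ := by
  obtain ⟨⟨x, y⟩, hw⟩ := u
  obtain ⟨y', hy'⟩ := exists_mem_lexSubgroup φ (x / m)
  have hm0 : (m : ℚ) ≠ 0 := Nat.cast_ne_zero.2 hm
  have h := (lexSubgroup φ).sub_mem hw ((lexSubgroup φ).nsmul_mem hy' m)
  have he : (toLex (x, y) : ℚ ×ₗ ℚ) - m • toLex (x / m, y') = toLex (0, y - m * y') := by
    rw [Prod.Lex.nsmul_toLex, mul_div_cancel₀ _ hm0, ← toLex_sub]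
    simp
  obtain ⟨k, hk⟩ := exists_intCast_of_mem_lexSubgroup φ (he ▸ h)
  refine ⟨⟨_, hy'⟩, k, Subtype.ext ?_⟩
  change (toLex (x, y) : ℚ ×ₗ ℚ) = m • toLex (x / m, y') + k • toLex (0, 1)
  rw [← sub_eq_iff_eq_add', he, Prod.Lex.zsmul_toLex, hk]
  simp

theorem ordConnected_zmultiples_lexUnit :
    ((AddSubgroup.zmultiples (lexUnit φ) : AddSubgroup (lexSubgroup φ)) :
      Set (lexSubgroup φ)).OrdConnected := by
  refine ⟨?_⟩
  rintro _ ⟨a, rfl⟩ _ ⟨b, rfl⟩ ⟨⟨x, y⟩, hw⟩ ⟨ha, hb⟩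
  change a • toLex ((0 : ℚ), (1 : ℚ)) ≤ toLex (x, y) at ha
  change toLex (x, y) ≤ b • toLex ((0 : ℚ), (1 : ℚ)) at hb
  rw [Prod.Lex.zsmul_toLex, Prod.Lex.toLex_le_toLex] at ha hb
  simp only [mul_zero] at ha hb
  obtain rfl : x = 0 := by
    rcases ha with ha | ⟨ha, _⟩
    · rcases hb with hb | ⟨hb, _⟩
      · exact absurd hb ha.not_gt
      · exact hb
    · exact ha.symm
  obtain ⟨k, rfl⟩ := exists_intCast_of_mem_lexSubgroup φ hw
  refine ⟨k, Subtype.ext ?_⟩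
  change k • toLex ((0 : ℚ), (1 : ℚ)) = toLex (0, (k : ℚ))
  rw [Prod.Lex.zsmul_toLex]
  simp

theorem lexTurn_notMem_zmultiples_lexUnit : lexTurn φ ∉ AddSubgroup.zmultiples (lexUnit φ) := by
  rintro ⟨k, hk⟩
  exact (zsmul_lexUnit_lt_lexTurn φ k).ne hk

theorem satisfiesD_lexUnit_iff (p : Nat.Primes) (n : ℕ+) {k : ℕ} (hk : k < (p : ℕ) ^ (n : ℕ)) :
    SatisfiesD (lexUnit φ : lexSubgroup φ ⧸ AddSubgroup.zmultiples (lexTurn φ))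
      ((p : ℕ) ^ (n : ℕ)) k ↔ k = digitSum φ p n := by
  have hgen : toLex (1 / (p : ℚ) ^ (n : ℕ), (digitSum φ p n : ℚ) / (p : ℚ) ^ (n : ℕ)) ∈
    lexSubgroup φ := AddSubgroup.subset_closure (Or.inr ⟨p, n, rfl⟩)
  have hd := digitSum_lt φ p n
  have hq2 : 2 ≤ (p : ℕ) ^ (n : ℕ) := p.2.two_le.trans (Nat.le_self_pow n.ne_zero _)
  rw [← Nat.cast_pow] at hgen
  generalize (p : ℕ) ^ (n : ℕ) = q at *
  generalize digitSum φ p n = d at *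
  have hq0 : (0 : ℚ) < q := by
    have : 0 < q := by omega
    exact_mod_cast this
  have hq1 : (((q - 1 : ℕ)) : ℚ) = q - 1 := by
    rw [Nat.cast_sub (by omega), Nat.cast_one]
  constructor
  · intro h
    obtain ⟨⟨⟨x, y⟩, hw⟩, m, h0, h1, h2⟩ := h.exists_rep hq2
    change toLex ((0 : ℚ), (0 : ℚ)) < toLex (x, y) at h0
    change (q - 1) • toLex (x, y) < toLex ((1 : ℚ), (0 : ℚ)) at h1
    have h2' : q • toLex (x, y) = k • toLex ((0 : ℚ), (1 : ℚ)) + m • toLex ((1 : ℚ), (0 : ℚ)) :=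
      congrArg Subtype.val h2
    rw [Prod.Lex.nsmul_toLex, Prod.Lex.nsmul_toLex, Prod.Lex.zsmul_toLex, ← toLex_add,
      toLex_inj, Prod.mk_add_mk, Prod.mk.injEq] at h2'
    simp only [mul_zero, mul_one, zero_add, add_zero] at h2'
    obtain ⟨hx, hy⟩ := h2'
    rw [Prod.Lex.toLex_lt_toLex] at h0
    rw [Prod.Lex.nsmul_toLex, Prod.Lex.toLex_lt_toLex, hq1] at h1
    simp only at h0 h1
    have hk0 : (0 : ℚ) ≤ k := k.cast_nonneg
    have hqq : (2 : ℚ) ≤ q := by exact_mod_cast hq2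
    have hkq : (k : ℚ) < q := by exact_mod_cast hk
    have hm0 : 0 ≤ m := by
      have : (0 : ℚ) ≤ m := by
        rw [← hx]
        have : 0 ≤ x := by
          rcases h0 with h0 | h0
          · exact h0.le
          · exact h0.1.le
        positivity
      exact_mod_cast this
    have hy0 : 0 ≤ y := by
      rw [← mul_nonneg_iff_of_pos_left hq0, hy]
      exact hk0
    -- If `m ≥ 2`, then `(q - 1)x = (q - 1)m/q ≥ 1` because `q ≥ 2`; in case of equality, `y ≥ 0`
    -- still contradicts `(q - 1)(x, y) < (1, 0)`.
    have hm2 : m < 2 := by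
      by_contra hm
      have hm' : (2 : ℚ) ≤ m := by exact_mod_cast not_lt.1 hm
      have hx1 : 1 ≤ (q - 1) * x := by
        rw [← mul_le_mul_iff_right₀ hq0]
        have : (q : ℚ) * ((q - 1) * x) = (q - 1) * m := by rw [← hx]; ring
        rw [this]
        nlinarith
      rcases h1 with h1 | h1
      · exact h1.not_ge hx1
      · have : 0 ≤ ((q : ℚ) - 1) * y := mul_nonneg (by linarith) hy0
        exact h1.2.not_ge this
    have hm : m = 0 ∨ m = 1 := by omega
    rcases hm with rfl | rfl
    -- No turn: the lift is `(0, j)` with `j ≥ 1`, so `k = q j ≥ q`.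
    · have hx0 : x = 0 := by
        rw [Int.cast_zero] at hx
        exact (mul_eq_zero.1 hx).resolve_left hq0.ne'
      subst hx0
      obtain ⟨j, rfl⟩ := exists_intCast_of_mem_lexSubgroup φ hw
      have hj0 : 0 < j := by
        rcases h0 with h0 | h0
        · exact absurd h0 (lt_irrefl _)
        · exact_mod_cast h0.2
      have hj1 : (1 : ℚ) ≤ j := by exact_mod_cast hj0
      nlinarith
    -- One turn: the lift and the generator share the first coordinate `1/q`, so `(k - d)/q` is an
    -- integer.
    · have h3 := (lexSubgroup φ).sub_mem hw hgen
      have hx1 : x = 1 / q := by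
        rw [eq_div_iff hq0.ne', mul_comm, hx, Int.cast_one]
      have hy1 : y = k / q := by
        rw [eq_div_iff hq0.ne', mul_comm, hy]
      have h4 : (toLex (x, y) : ℚ ×ₗ ℚ) - toLex (1 / (q : ℚ), (d : ℚ) / q) =
          toLex (0, ((k : ℚ) - d) / q) := by
        rw [← toLex_sub, Prod.mk_sub_mk, hx1, hy1, sub_self, sub_div]
      obtain ⟨j, hj⟩ := exists_intCast_of_mem_lexSubgroup φ (h4 ▸ h3)
      rw [div_eq_iff hq0.ne'] at hj
      have hj' : (k : ℤ) - d = j * q := by exact_mod_cast hj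
      have hj0 : j = 0 := by
        have h5 : j * q < 1 * q := by omega
        have h6 : -1 * q < j * (q : ℤ) := by omega
        have hqz : (0 : ℤ) < q := by omega
        have := lt_of_mul_lt_mul_right h5 hqz.le
        have := lt_of_mul_lt_mul_right h6 hqz.le
        omega
      rw [hj0] at hj'
      omega
  · rintro rfl
    -- The generator `(1/q, k/q)` itself is the witness.
    refine satisfiesD_mk (y := ⟨_, hgen⟩) ?_ ?_ (Subtype.ext ?_)
    · change toLex ((0 : ℚ), (0 : ℚ)) < toLex (1 / (q : ℚ), (k : ℚ) / q)
      rw [Prod.Lex.toLex_lt_toLex]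
      exact Or.inl (by simpa using hq0)
    · change (q - 1) • toLex (1 / (q : ℚ), (k : ℚ) / q) < toLex ((1 : ℚ), (0 : ℚ))
      rw [Prod.Lex.nsmul_toLex, Prod.Lex.toLex_lt_toLex, hq1]
      left
      simp only
      rw [mul_one_div, div_lt_one hq0]
      linarith
    · change q • toLex (1 / (q : ℚ), (k : ℚ) / q) =
        k • toLex ((0 : ℚ), (1 : ℚ)) + toLex ((1 : ℚ), (0 : ℚ))
      rw [Prod.Lex.nsmul_toLex, Prod.Lex.nsmul_toLex, ← toLex_add, mul_div_cancel₀ _ hq0.ne',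
        mul_div_cancel₀ _ hq0.ne']
      simp

end LexSubgroup

end CyclicGroup

theorem mainTheorem11 (φ : (p : Nat.Primes) → ℕ+ → Fin p) :
    ∃ (H : Type) (_ : AddCommGroup H) (_ : CircularOrder H) (_ : IsCyclicallyOrderedAddGroup H),
      ¬ CyclicGroup.IsCArchimedean H ∧
      CyclicGroup.IsDiscrete H ∧
      CyclicGroup.IsCRegular H ∧
      CyclicGroup.IsCharacteristicSequence H φ ∧
      CyclicGroup.IsWoundRound H (CyclicGroup.lexSubgroup φ)
        ⟨toLex (1, 0), CyclicGroup.one_zero_mem_lexSubgroup φ⟩ := by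
  have harch := CyclicGroup.not_isCArchimedean_quotient (z := CyclicGroup.lexTurn φ)
    (CyclicGroup.ordConnected_zmultiples_lexUnit φ)
    (CyclicGroup.lexTurn_notMem_zmultiples_lexUnit φ)
    (AddSubgroup.mem_zmultiples _) (CyclicGroup.lexUnit_pos φ)
  have hfirst := CyclicGroup.isFirstPositive_mk (z := CyclicGroup.lexTurn φ)
    (CyclicGroup.lexUnit_pos φ) (fun _ => CyclicGroup.lexUnit_le φ)
    (by simpa using CyclicGroup.zsmul_lexUnit_lt_lexTurn φ 1)
  refine ⟨CyclicGroup.lexSubgroup φ ⧸ AddSubgroup.zmultiples (CyclicGroup.lexTurn φ),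
    inferInstance, inferInstance, inferInstance, harch, ⟨_, hfirst⟩,
    CyclicGroup.isCRegular_quotient (CyclicGroup.lexUnit_pos φ)
      (fun _ => CyclicGroup.lexUnit_le φ)
      (fun _ hm u => CyclicGroup.exists_eq_nsmul_add_zsmul_lexUnit φ hm u),
    ⟨harch, _, hfirst, ?_, fun p n _ hk => CyclicGroup.satisfiesD_lexUnit_iff φ p n hk⟩,
    CyclicGroup.isWoundRound_quotient (CyclicGroup.lexTurn φ)⟩
  -- Divisibility of `H/⟨1_H⟩`: lift through both quotients to `W`, where `u = m v + k (0,1)`, and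
  -- the last term dies.
  intro m hm x
  obtain ⟨x, rfl⟩ := QuotientAddGroup.mk_surjective x
  obtain ⟨u, rfl⟩ := QuotientAddGroup.mk_surjective x
  obtain ⟨v, k, rfl⟩ := CyclicGroup.exists_eq_nsmul_add_zsmul_lexUnit φ hm u
  refine ⟨((v : CyclicGroup.lexSubgroup φ ⧸
    AddSubgroup.zmultiples (CyclicGroup.lexTurn φ)) : _ ⧸ _), ?_⟩
  rw [← QuotientAddGroup.mk_nsmul, QuotientAddGroup.mk_add, QuotientAddGroup.mk_nsmul,
    QuotientAddGroup.mk_zsmul, CyclicGroup.mk_add_zsmul]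
  rfl
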